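/- Let $m,d,L\ge 2$ be integers. For $m$ parties $\mathsf A_1,\dots,\mathsf A_m$, each holding a qudit $\mathbb C^d$, let $\mathbb 1$ be the identity on $(\mathbb C^d)^{\otimes m}$, $\Psi_i=|i\cdots i\rangle\langle i\cdots i|$ for $i=0,\dots,d-1$, and $\Phi=\frac1d\sum_{i,j=0}^{d-1}|i\cdots i\rangle\langle j\cdots j|$ (the GHZ state). Let $\mathcal E=\{\eta_i,\rho_i\}_{i=1}^{d+2}$ be the ensemble $$\eta_i=\tfrac{1}{d^m+d},\ \rho_i=\Psi_{i-1}\ (1\le i\le d);\qquad \eta_{d+1}=\tfrac{d^m-d}{d^m+d},\ \rho_{d+1}=\tfrac{1}{d^m-d}\Big(\mathbb 1-\sum_{j=0}^{d-1}\Psi_j\Big);\qquad \eta_{d+2}=\tfrac{d}{d^m+d},\ \rho_{d+2}=\Phi .$$ Let $\mathcal E^{\otimes L}=\{\eta_{\vec c},\rho_{\vec c}\}$ be the sequence ensemble of $L$ copies of $\mathcal E$, where $\vec c\in\{1,\dots,d+2\}^L$, $\eta_{\vec c}=\prod_l\eta_{c_l}$, $\rho_{\vec c}=\bigotimes_l\rho_{c_l}$,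 and each party holds its $L$ qudits. For an ensemble $\mathcal F=\{\eta_x,\rho_x\}_x$ of $m$-party states let $p_{\sf G}(\mathcal F)$, $p_{\sf SEP}(\mathcal F)$ and $p_{\sf L}(\mathcal F)$ be the optimal value of $\sum_x\eta_x\operatorname{Tr}(\rho_xM_x)$ over all measurements $\{M_x\}$ (positive-semidefinite operators with sum the identity), over those whose operators are all separable (finite sums of tensor products of positive-semidefinite local operators), and over those that can be realized by finitely many rounds of local operations and classical communication (LOCC) among the parties. A Hermitian operator $E$ is block positive if $\operatorname{Tr}(E\sigma)\ge 0$ for every separable state $\sigma$. Put $$M_i=\Psi_{i-1}\ (1\le i\le d),\quad M_{d+1}=\mathbb 1-\sum_{j=0}^{d-1}\Psi_j,\quad M_{d+2}=0,\qquad M_{\vec c}=\bigotimes_{l=1}^L M_{c_l},\qquad H=\tfrac{1}{(d^m+d)^L}\,\mathbb 1^{\otimes L}.$$ Then: 1. $\rho_1,\dots,\rho_{d+1}$ are separable and $\rho_{d+2}$ is not. 2. $\{M_i\}$ is obtained by measuring every party in the computational basis and classically processing the results; $\{M_i\}$ and $\{M_{\vec c}\}$ are LOCC measurements. 3. $H$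 is Hermitian and, for every $\vec c$, $H-\eta_{\vec c}\rho_{\vec c}$ is block positive and $\operatorname{Tr}[M_{\vec c}(H-\eta_{\vec c}\rho_{\vec c})]=0$. 4. The optimal LOCC discrimination of $\mathcal E^{\otimes L}$ is factorizable and optimal among separable measurements: $p_{\sf L}(\mathcal E)^L=p_{\sf L}(\mathcal E^{\otimes L})=p_{\sf SEP}(\mathcal E^{\otimes L})$; the measurements $\{M_i\}$ and $\{M_{\vec c}\}$ attain $p_{\sf L}(\mathcal E)$ and $p_{\sf L}(\mathcal E^{\otimes L})$. 5. $\max_i\eta_i<p_{\sf L}(\mathcal E)=\frac{d^m}{d^m+d}<p_{\sf G}(\mathcal E)$. 6. $\max_{\vec c}\eta_{\vec c}<p_{\sf L}(\mathcal E^{\otimes L})<p_{\sf G}(\mathcal E^{\otimes L})$. -/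

import Mathlib

open scoped ComplexOrder Matrix

namespace SeqDisc

/-- The product operator `⨂ₖ B k` from `⨂ₖ ℂ^(X k)` to `⨂ₖ ℂ^(Y k)`, in the product basis. -/
def prodOp {m : ℕ} {X Y : Fin m → Type} (B : ∀ k, Matrix (Y k) (X k) ℂ) :
    Matrix (∀ k, Y k) (∀ k, X k) ℂ :=
  Matrix.of fun y x => ∏ k, B k (y k) (x k)

/-- The tensor product `⨂ₗ A l` of operators on `m`-party spaces `⨂ₖ ℂ^(X l k)`. It acts on the
`m`-party space in which party `k` holds `⨂ₗ ℂ^(X l k)`, its shares of all members of the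
sequence. -/
def seqOp {m L : ℕ} {X : Fin L → Fin m → Type}
    (A : ∀ l, Matrix (∀ k, X l k) (∀ k, X l k) ℂ) :
    Matrix (∀ k, ∀ l, X l k) (∀ k, ∀ l, X l k) ℂ :=
  Matrix.of fun a b => ∏ l, A l (fun k => a k l) (fun k => b k l)

/-- Separable operators: finite sums of positive-semidefinite product operators. -/
def IsSepOp {m : ℕ} {X : Fin m → Type} [∀ k, Fintype (X k)]
    (E : Matrix (∀ k, X k) (∀ k, X k) ℂ) : Prop :=
  ∃ (r : ℕ) (F : Fin r → ∀ k, Matrix (X k) (X k) ℂ),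
    (∀ s k, (F s k).PosSemidef) ∧ E = ∑ s, prodOp (F s)

/-- Block-positive operators: Hermitian, with nonnegative mean value on every separable state. -/
def IsBlockPositive {m : ℕ} {X : Fin m → Type} [∀ k, Fintype (X k)]
    (E : Matrix (∀ k, X k) (∀ k, X k) ℂ) : Prop :=
  E.IsHermitian ∧
    ∀ σ : Matrix (∀ k, X k) (∀ k, X k) ℂ, IsSepOp σ → σ.trace = 1 → 0 ≤ (E * σ).trace.re

/-- Measurements with outcome set `Ω` on a finite-dimensional space. -/
def IsMeasurement {V Ω : Type} [Fintype V] [DecidableEq V] [Fintype Ω]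
    (M : Ω → Matrix V V ℂ) : Prop :=
  (∀ i, (M i).PosSemidef) ∧ ∑ i, M i = 1

/-- Measurements that are realized by a finite protocol of local operations and classical
communication.

* `guess o`: without any further interaction, the outcome `o` is announced.
* `round k`: party `k` performs a local operation with Kraus operators `B a k`, broadcasts the
  result `a`, every other party `j` applies a local isometry `B a j` (for instance, it adjoins an
  ancilla, or does nothing), and the parties continue with an LOCC protocol, which may depend on
  `a`, for the measurement `N a`. The local dimensions may change in every round.

A local channel is a round whose result is not used in what follows; shared randomness is a round
with Kraus operators `√p_a • 1`; coarse-graining amounts to the same announcement at several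
leaves. -/
inductive IsLOCC {m : ℕ} {Ω : Type} [DecidableEq Ω] :
    ∀ (X : Fin m → Type) [∀ k, Fintype (X k)] [∀ k, DecidableEq (X k)],
      (Ω → Matrix (∀ k, X k) (∀ k, X k) ℂ) → Prop
  | guess (X : Fin m → Type) [∀ k, Fintype (X k)] [∀ k, DecidableEq (X k)] (o : Ω) :
      IsLOCC X (fun i => if i = o then 1 else 0)
  | round (X : Fin m → Type) [∀ k, Fintype (X k)] [∀ k, DecidableEq (X k)] (k : Fin m) (r : ℕ)
      (Y : Fin r → Fin m → Type) [∀ a j, Fintype (Y a j)] [∀ a j, DecidableEq (Y a j)]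
      (B : ∀ a j, Matrix (Y a j) (X j) ℂ)
      (kraus : ∑ a, (B a k)ᴴ * B a k = 1)
      (isometry : ∀ a j, j ≠ k → (B a j)ᴴ * B a j = 1)
      (N : ∀ a, Ω → Matrix (∀ j, Y a j) (∀ j, Y a j) ℂ)
      (next : ∀ a, IsLOCC (Y a) (N a)) :
      IsLOCC X (fun i => ∑ a, (prodOp (B a))ᴴ * N a i * prodOp (B a))

/-- Ensembles `{η i, ρ i}` of states of an `m`-party system, with nonzero probabilities. -/
structure Ensemble {m : ℕ} (X : Fin m → Type) [∀ k, Fintype (X k)] (Ω : Type) [Fintype Ω] where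
  η : Ω → ℝ
  ρ : Ω → Matrix (∀ k, X k) (∀ k, X k) ℂ
  η_pos : ∀ i, 0 < η i
  η_sum : ∑ i, η i = 1
  ρ_posSemidef : ∀ i, (ρ i).PosSemidef
  ρ_trace : ∀ i, (ρ i).trace = 1

namespace Ensemble

variable {m : ℕ} {X : Fin m → Type} [∀ k, Fintype (X k)] [∀ k, DecidableEq (X k)]
  {Ω : Type} [Fintype Ω] [DecidableEq Ω]

/-- The average probability of guessing the prepared state correctly by the measurement `M`. -/
noncomputable def success (E : Ensemble X Ω) (M : Ω → Matrix (∀ k, X k) (∀ k, X k) ℂ) : ℝ :=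
  ∑ i, E.η i * (E.ρ i * M i).trace.re

/-- The optimal success probability over all measurements. -/
noncomputable def pG (E : Ensemble X Ω) : ℝ :=
  sSup {p | ∃ M, IsMeasurement M ∧ p = E.success M}

/-- The optimal success probability over separable measurements. -/
noncomputable def pSEP (E : Ensemble X Ω) : ℝ :=
  sSup {p | ∃ M, IsMeasurement M ∧ (∀ i, IsSepOp (M i)) ∧ p = E.success M}

/-- The optimal success probability over LOCC measurements. -/
noncomputable def pL (E : Ensemble X Ω) : ℝ :=
  sSup {p | ∃ M, IsMeasurement M ∧ IsLOCC X M ∧ p = E.success M}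

end Ensemble

theorem seqOp_posSemidef {m L : ℕ} {X : Fin L → Fin m → Type} [∀ l k, Fintype (X l k)]
    (A : ∀ l, Matrix (∀ k, X l k) (∀ k, X l k) ℂ) (hA : ∀ l, (A l).PosSemidef) :
    (seqOp A).PosSemidef := by
  classical
  have h : ∀ l, ∃ B : Matrix (∀ k, X l k) (∀ k, X l k) ℂ, A l = Bᴴ * B := fun l =>
    by
    open scoped MatrixOrder in
    exact CStarAlgebra.nonneg_iff_eq_star_mul_self.mp (hA l).nonneg
  choose B hB using h
  have key : seqOp A = (seqOp B)ᴴ * seqOp B := by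
    ext a b
    simp only [seqOp, Matrix.of_apply, Matrix.mul_apply, Matrix.conjTranspose_apply, hB,
      Finset.prod_univ_sum, Fintype.piFinset_univ, star_prod, ← Finset.prod_mul_distrib]
    exact Fintype.sum_equiv (Equiv.piComm _) _ _ (fun _ => rfl)
  rw [key]
  exact Matrix.posSemidef_conjTranspose_mul_self _

theorem seqOp_trace {m L : ℕ} {X : Fin L → Fin m → Type} [∀ l k, Fintype (X l k)]
    (A : ∀ l, Matrix (∀ k, X l k) (∀ k, X l k) ℂ) :
    (seqOp A).trace = ∏ l, (A l).trace := by
  classical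
  simp only [seqOp, Matrix.trace, Matrix.diag_apply, Matrix.of_apply, Finset.prod_univ_sum,
    Fintype.piFinset_univ]
  exact Fintype.sum_equiv (Equiv.piComm _) _ _ (fun _ => rfl)

/-- The sequence ensemble `⨂ₗ E l = {η_c, ρ_c}`, with `η_c = ∏ₗ η_{c l}` and `ρ_c = ⨂ₗ ρ_{c l}`. -/
def Ensemble.seq {m L : ℕ} {X : Fin L → Fin m → Type} [∀ l k, Fintype (X l k)]
    {Ω : Fin L → Type} [∀ l, Fintype (Ω l)] (E : ∀ l, Ensemble (X l) (Ω l)) :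
    Ensemble (fun k => ∀ l, X l k) (∀ l, Ω l) where
  η c := ∏ l, (E l).η (c l)
  ρ c := seqOp fun l => (E l).ρ (c l)
  η_pos c := Finset.prod_pos fun l _ => (E l).η_pos (c l)
  η_sum := by
    have h := Finset.prod_univ_sum (fun l => (Finset.univ : Finset (Ω l))) (fun l => (E l).η)
    rw [Fintype.piFinset_univ] at h
    rw [← h]
    exact Finset.prod_eq_one fun l _ => (E l).η_sum
  ρ_posSemidef c := seqOp_posSemidef _ fun l => (E l).ρ_posSemidef (c l)
  ρ_trace c := by
    rw [seqOp_trace]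
    exact Finset.prod_eq_one fun l _ => (E l).ρ_trace (c l)

/-- The optimal LOCC discrimination of `⨂ₗ E l` is factorizable. -/
def Factorizable {m L : ℕ} {X : Fin L → Fin m → Type} [∀ l k, Fintype (X l k)]
    [∀ l k, DecidableEq (X l k)] {Ω : Fin L → Type} [∀ l, Fintype (Ω l)]
    [∀ l, DecidableEq (Ω l)] (E : ∀ l, Ensemble (X l) (Ω l)) : Prop :=
  (Ensemble.seq E).pL = ∏ l, (E l).pL

/-- The vector `|i⋯i⟩` of `m` qudits. -/
def diagKet (m d : ℕ) (i : Fin d) : (Fin m → Fin d) → ℂ :=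
  Pi.single (fun _ => i) 1

/-- The projector `Ψ_i = |i⋯i⟩⟨i⋯i|`. -/
def Psi (m d : ℕ) (i : Fin d) : Matrix (Fin m → Fin d) (Fin m → Fin d) ℂ :=
  Matrix.vecMulVec (diagKet m d i) (star (diagKet m d i))

/-- The GHZ vector `d^(-1/2) ∑ᵢ |i⋯i⟩`. -/
noncomputable def ghzKet (m d : ℕ) : (Fin m → Fin d) → ℂ :=
  ((1 / Real.sqrt d : ℝ) : ℂ) • ∑ i, diagKet m d i

/-- The GHZ state `Φ`. -/
noncomputable def Phi (m d : ℕ) : Matrix (Fin m → Fin d) (Fin m → Fin d) ℂ :=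
  Matrix.vecMulVec (ghzKet m d) (star (ghzKet m d))

/-- The prior probabilities of the example; the label `i` stands for `i + 1` in `1, …, d + 2`. -/
noncomputable def exProb (m d : ℕ) (i : Fin (d + 2)) : ℝ :=
  if i.val < d then 1 / ((d : ℝ) ^ m + d)
  else if i.val = d then ((d : ℝ) ^ m - d) / ((d : ℝ) ^ m + d)
  else d / ((d : ℝ) ^ m + d)

/-- The states of the example. -/
noncomputable def exState (m d : ℕ) (i : Fin (d + 2)) :
    Matrix (Fin m → Fin d) (Fin m → Fin d) ℂ :=
  if h : i.val < d then Psi m d ⟨i.val, h⟩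
  else if i.val = d then (1 / ((d : ℝ) ^ m - d)) • (1 - ∑ j, Psi m d j)
  else Phi m d

/-- The measurement of the example. -/
def exMeas (m d : ℕ) (i : Fin (d + 2)) : Matrix (Fin m → Fin d) (Fin m → Fin d) ℂ :=
  if h : i.val < d then Psi m d ⟨i.val, h⟩
  else if i.val = d then 1 - ∑ j, Psi m d j
  else 0

theorem lt_pow_of_two_le {m d : ℕ} (hm : 2 ≤ m) (hd : 2 ≤ d) : (d : ℝ) < (d : ℝ) ^ m := by
  have h : d ^ 1 < d ^ m := Nat.pow_lt_pow_right (by omega) (by omega)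
  rw [pow_one] at h
  exact_mod_cast h

theorem trace_Psi (m d : ℕ) (i : Fin d) : (Psi m d i).trace = 1 := by
  rw [Psi, Matrix.trace_vecMulVec]
  simp [diagKet]

theorem sum_Psi_eq {m d : ℕ} (hm : 2 ≤ m) :
    ∑ j, Psi m d j =
      Matrix.diagonal fun x : Fin m → Fin d => if ∃ j, x = fun _ => j then (1 : ℂ) else 0 := by
  ext x y
  rw [Matrix.sum_apply, Matrix.diagonal_apply]
  simp only [Psi, diagKet, Matrix.vecMulVec_apply, Pi.star_apply, Pi.single_apply]
  by_cases hx : ∃ j, x = fun _ => j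
  · obtain ⟨j, rfl⟩ := hx
    have hj : ∀ i : Fin d, ((fun _ : Fin m => j) = fun _ => i) ↔ j = i := fun i =>
      ⟨fun h => congrFun h ⟨0, by omega⟩, fun h => by rw [h]⟩
    have hy : ∀ i : Fin d, (if j = i then (1 : ℂ) else 0) * star (if y = fun _ => i then (1 : ℂ)
        else 0) = if j = i then (if y = fun _ => j then 1 else 0) else 0 := by
      intro i
      by_cases h : j = i
      · subst h
        split_ifs <;> simp
      · simp [h]
    simp only [hj, hy, Finset.sum_ite_eq, Finset.mem_univ, if_true]
    simp [eq_comm (a := y)]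
  · have hx' : ∀ i, ¬ x = fun _ => i := fun i h => hx ⟨i, h⟩
    simp [hx']

theorem trace_complement {m d : ℕ} :
    (1 - ∑ j, Psi m d j).trace = (((d : ℝ) ^ m - d : ℝ) : ℂ) := by
  simp [Matrix.trace_sub, Matrix.trace_sum, trace_Psi]

theorem posSemidef_complement {m d : ℕ} (hm : 2 ≤ m) : (1 - ∑ j, Psi m d j).PosSemidef := by
  rw [sum_Psi_eq hm, ← Matrix.diagonal_one, Matrix.diagonal_sub]
  refine Matrix.PosSemidef.diagonal fun x => ?_
  by_cases h : ∃ j, x = fun _ => j <;> simp [h]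

theorem trace_Phi {m d : ℕ} (hm : 2 ≤ m) (hd : 2 ≤ d) : (Phi m d).trace = 1 := by
  have h0 : (d : ℝ) ≠ 0 := by positivity
  have hs : (∑ i, diagKet m d i) ⬝ᵥ star (∑ i, diagKet m d i) = (d : ℂ) := by
    have hj : ∀ i j : Fin d, ((fun _ : Fin m => j) = fun _ => i) ↔ j = i := fun i j =>
      ⟨fun h => congrFun h ⟨0, by omega⟩, fun h => by rw [h]⟩
    simp [star_sum, dotProduct_sum, diagKet, Pi.single_apply, hj]
  rw [Phi, Matrix.trace_vecMulVec, ghzKet, star_smul, smul_dotProduct, dotProduct_smul, hs]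
  have hq : (1 / Real.sqrt d) * (1 / Real.sqrt d) * (d : ℝ) = 1 := by
    rw [div_mul_div_comm, Real.mul_self_sqrt (by positivity)]
    field_simp
  have hq' := congrArg (fun t : ℝ => (t : ℂ)) hq
  simpa [mul_assoc] using hq'

/-- The ensemble of the example. -/
noncomputable def exEnsemble (m d : ℕ) (hm : 2 ≤ m) (hd : 2 ≤ d) :
    Ensemble (fun _ : Fin m => Fin d) (Fin (d + 2)) where
  η := exProb m d
  ρ := exState m d
  η_pos i := by
    have h := lt_pow_of_two_le hm hd
    have hd0 : (0 : ℝ) < d := by positivity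
    unfold exProb
    split_ifs
    · positivity
    · exact div_pos (by linarith) (by positivity)
    · positivity
  η_sum := by
    have h0 : (d : ℝ) ^ m + d ≠ 0 := by positivity
    rw [Fin.sum_univ_castSucc, Fin.sum_univ_castSucc]
    simp [exProb]
    field_simp
    ring
  ρ_posSemidef i := by
    have h := lt_pow_of_two_le hm hd
    unfold exState
    split_ifs
    · exact Matrix.posSemidef_vecMulVec_self_star _
    · exact (posSemidef_complement hm).smul (one_div_nonneg.mpr (by linarith))
    · exact Matrix.posSemidef_vecMulVec_self_star _
  ρ_trace i := by
    have h := lt_pow_of_two_le hm hd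
    have h' : (((d : ℝ) ^ m - d : ℝ) : ℂ) ≠ 0 := by
      exact_mod_cast (sub_pos.mpr h).ne'
    unfold exState
    split_ifs
    · exact trace_Psi _ _ _
    · rw [Matrix.trace_smul, trace_complement, Complex.real_smul, Complex.ofReal_div,
        Complex.ofReal_one, one_div, inv_mul_cancel₀ h']
    · exact trace_Phi hm hd

/-- The sequence ensemble of the example: `L` identical copies of the ensemble. -/
noncomputable def exSeq (m d L : ℕ) (hm : 2 ≤ m) (hd : 2 ≤ d) :
    Ensemble (fun _ : Fin m => Fin L → Fin d) (Fin L → Fin (d + 2)) :=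
  Ensemble.seq fun _ : Fin L => exEnsemble m d hm hd

/-- The measurement `M_c = ⨂ₗ M_{c l}`: the measurement of the example is performed at each step. -/
def exSeqMeas (m d L : ℕ) (c : Fin L → Fin (d + 2)) :
    Matrix (Fin m → Fin L → Fin d) (Fin m → Fin L → Fin d) ℂ :=
  seqOp fun l => exMeas m d (c l)

/-- The operator `H = (d^m + d)^(-L) 𝟙 ⊗ ⋯ ⊗ 𝟙`. -/
noncomputable def exH (m d L : ℕ) : Matrix (Fin m → Fin L → Fin d) (Fin m → Fin L → Fin d) ℂ :=
  (1 / ((d : ℝ) ^ m + d) ^ L) •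
    seqOp fun _ : Fin L => (1 : Matrix (Fin m → Fin d) (Fin m → Fin d) ℂ)

end SeqDisc

open SeqDisc

/-!
A semidefinite-duality argument reduces optimality among separable measurements to block positivity
of the operators `H - η_c ρ_c`. Write `A_i = (d^m + d) η_i ρ_i`, so that
`H - η_c ρ_c = (d^m + d)^(-L) (1 - A_c)` with `A_c = ⨂ₗ A_{c l}`. The partial transpose of each
`A_i` is a Hermitian partial isometry: the projectors `A_i`, `i ≤ d + 1`, are diagonal and do not
change, and `A_{d+2} = d Φ` becomes a partial permutation matrix. Hermitian partial isometries
`W = W* = W³` are closed under tensor products and satisfy `W ≤ 1`, because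
`2 (1 - W) = (1 - W)² + (1 - W²)` and `1 - W²` is a projection. Since a separable state `σ` has a
positive-semidefinite partial transpose, `Tr (A_c σ) ≤ Tr σ`, which is the block positivity. The
same inequality shows that `Φ` is entangled, as `Tr (d Φ Φ) = d > 1`; a global measurement that
detects `Φ` without disturbing the other outcomes too much does better than any LOCC measurement.
-/

namespace SeqDisc

section Matrices

variable {𝕜 V : Type*} [RCLike 𝕜] [Fintype V]

theorem trace_mul_nonneg {A B : Matrix V V 𝕜} (hA : A.PosSemidef) (hB : B.PosSemidef) :
    0 ≤ (A * B).trace := by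
  classical
  obtain ⟨C, rfl⟩ : ∃ C : Matrix V V 𝕜, A = Cᴴ * C := by
    open scoped MatrixOrder in
    exact CStarAlgebra.nonneg_iff_eq_star_mul_self.mp hA.nonneg
  rw [Matrix.mul_assoc, Matrix.trace_mul_comm]
  exact (hB.mul_mul_conjTranspose_same C).trace_nonneg

theorem posSemidef_of_isStarProjection {P : Matrix V V 𝕜} (hP : IsStarProjection P) :
    P.PosSemidef := by
  have h := Matrix.posSemidef_conjTranspose_mul_self P
  rwa [← Matrix.star_eq_conjTranspose, hP.isSelfAdjoint.star_eq, hP.isIdempotentElem.eq] at h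

theorem isStarProjection_diagonal_ite [DecidableEq V] (p : V → Prop) [DecidablePred p] :
    IsStarProjection (Matrix.diagonal fun x => if p x then (1 : 𝕜) else 0) where
  isIdempotentElem := by simp [IsIdempotentElem, Matrix.diagonal_mul_diagonal]
  isSelfAdjoint := by
    rw [IsSelfAdjoint, Matrix.star_eq_conjTranspose, Matrix.diagonal_conjTranspose]
    congr 1
    ext x
    simp [apply_ite (star : 𝕜 → 𝕜)]

theorem sum_single_mul_sum_single [DecidableEq V] {ι : Type*} [Fintype ι] {b : ι → V}
    (hb : b.Injective) (a c : ι → V) :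
    (∑ p, Matrix.single (a p) (b p) (1 : 𝕜)) * ∑ p, Matrix.single (b p) (c p) 1 =
      ∑ p, Matrix.single (a p) (c p) 1 := by
  rw [Matrix.sum_mul]
  refine Finset.sum_congr rfl fun p _ => ?_
  rw [Matrix.mul_sum, Finset.sum_eq_single p, Matrix.single_mul_single_same, mul_one]
  · exact fun q _ hqp => Matrix.single_mul_single_of_ne _ _ _ _ (hb.ne hqp.symm) _
  · simp

/-- Hermitian partial isometries, i.e. Hermitian matrices with all eigenvalues in `{-1, 0, 1}`. In
contrast to the contractions, they are a class that is visibly closed under tensor products. -/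
structure IsHermitianPartialIsometry (W : Matrix V V 𝕜) : Prop where
  isHermitian : W.IsHermitian
  mul_mul_self : W * W * W = W

namespace IsHermitianPartialIsometry

theorem of_isStarProjection {P : Matrix V V 𝕜} (hP : IsStarProjection P) :
    IsHermitianPartialIsometry P where
  isHermitian := hP.isSelfAdjoint
  mul_mul_self := by rw [hP.isIdempotentElem.eq, hP.isIdempotentElem.eq]

theorem posSemidef_one_sub [DecidableEq V] {W : Matrix V V 𝕜}
    (hW : IsHermitianPartialIsometry W) : (1 - W).PosSemidef := by
  have h_herm : (1 - W).IsHermitian := Matrix.isHermitian_one.sub hW.isHermitian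
  have h_sq : ((1 - W) * (1 - W)).PosSemidef := by
    have h := Matrix.posSemidef_conjTranspose_mul_self (1 - W)
    rwa [h_herm.eq] at h
  have h_proj : IsStarProjection (1 - W * W) := by
    refine IsStarProjection.one_sub ⟨?_, ?_⟩
    · rw [IsIdempotentElem, ← mul_assoc, hW.mul_mul_self]
    · exact sq W ▸ hW.isHermitian.isSelfAdjoint.pow 2
  have h_sum : (2 : ℝ) • (1 - W) = (1 - W) * (1 - W) + (1 - W * W) := by
    rw [two_smul]
    noncomm_ring
  rw [← inv_smul_smul₀ (two_ne_zero' ℝ) (1 - W), h_sum]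
  exact (h_sq.add (posSemidef_of_isStarProjection h_proj)).smul (by norm_num)

end IsHermitianPartialIsometry

end Matrices

section ProductOperators

variable {m : ℕ} {X Y Z : Fin m → Type}

theorem prodOp_mul [∀ k, Fintype (Y k)] (A : ∀ k, Matrix (Z k) (Y k) ℂ)
    (B : ∀ k, Matrix (Y k) (X k) ℂ) :
    prodOp A * prodOp B = prodOp fun k => A k * B k := by
  ext z x
  simp only [prodOp, Matrix.mul_apply, Matrix.of_apply, ← Finset.prod_mul_distrib,
    Finset.prod_univ_sum, Fintype.piFinset_univ]

theorem prodOp_conjTranspose (B : ∀ k, Matrix (Y k) (X k) ℂ) :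
    (prodOp B)ᴴ = prodOp fun k => (B k)ᴴ := by
  ext x y
  simp [prodOp, Matrix.conjTranspose_apply]

theorem prodOp_smul (c : Fin m → ℝ) (B : ∀ k, Matrix (Y k) (X k) ℂ) :
    prodOp (fun k => c k • B k) = (∏ k, c k) • prodOp B := by
  ext y x
  simp [prodOp, Finset.prod_mul_distrib]

theorem prodOp_single [∀ k, DecidableEq (X k)] [∀ k, DecidableEq (Y k)] (y : ∀ k, Y k)
    (x : ∀ k, X k) (c : Fin m → ℂ) :
    prodOp (fun k => Matrix.single (y k) (x k) (c k)) = Matrix.single y x (∏ k, c k) := by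
  ext y' x'
  simp only [prodOp, Matrix.of_apply, Matrix.single_apply, Fintype.prod_ite_zero, funext_iff,
    forall_and]

theorem prodOp_diagonal [∀ k, DecidableEq (X k)] (v : ∀ k, X k → ℂ) :
    prodOp (fun k => Matrix.diagonal (v k)) = Matrix.diagonal fun x => ∏ k, v k (x k) := by
  ext x y
  simp only [prodOp, Matrix.of_apply, Matrix.diagonal_apply, Fintype.prod_ite_zero, funext_iff]
  congr

theorem prodOp_one [∀ k, DecidableEq (X k)] :
    prodOp (fun k => (1 : Matrix (X k) (X k) ℂ)) = 1 := by
  simp only [← Matrix.diagonal_one, prodOp_diagonal, Finset.prod_const_one]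

theorem prodOp_posSemidef [∀ k, Finite (X k)] {A : ∀ k, Matrix (X k) (X k) ℂ}
    (hA : ∀ k, (A k).PosSemidef) : (prodOp A).PosSemidef := by
  classical
  have := fun k => Fintype.ofFinite (X k)
  have h_sq : ∀ k, ∃ B : Matrix (X k) (X k) ℂ, A k = Bᴴ * B := fun k => by
    open scoped MatrixOrder in
    exact CStarAlgebra.nonneg_iff_eq_star_mul_self.mp (hA k).nonneg
  choose B hB using h_sq
  rw [show A = fun k => (B k)ᴴ * B k from funext hB, ← prodOp_mul, ← prodOp_conjTranspose]
  exact Matrix.posSemidef_conjTranspose_mul_self _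

/-- The operator `K` of party `k`, tensored with the identities of the other parties. -/
def localOp [∀ k, DecidableEq (X k)] (k : Fin m) (K : Matrix (X k) (X k) ℂ) :
    Matrix (∀ k, X k) (∀ k, X k) ℂ :=
  prodOp (Function.update (fun _ => 1) k K)

theorem localOp_diagonal [∀ k, DecidableEq (X k)] (k : Fin m) (v : X k → ℂ) :
    localOp k (Matrix.diagonal v) = Matrix.diagonal fun x => v (x k) := by
  have h_update : Function.update (fun _ => 1) k (Matrix.diagonal v) =
      fun j => Matrix.diagonal (Function.update (fun j (_ : X j) => (1 : ℂ)) k v j) := by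
    ext1 j
    rw [Function.apply_update (fun _ => Matrix.diagonal)]
    rfl
  rw [localOp, h_update, prodOp_diagonal]
  congr 1
  ext x
  rw [Finset.prod_eq_single k (fun j _ hj => by simp [hj]) (by simp), Function.update_self]

end ProductOperators

section SequenceOperators

variable {m L : ℕ} {X : Fin L → Fin m → Type}

theorem seqOp_mul [∀ l k, Fintype (X l k)] (A B : ∀ l, Matrix (∀ k, X l k) (∀ k, X l k) ℂ) :
    seqOp A * seqOp B = seqOp fun l => A l * B l := by
  classical
  ext a b
  simp only [seqOp, Matrix.of_apply, Matrix.mul_apply, Finset.prod_univ_sum,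
    Fintype.piFinset_univ, ← Finset.prod_mul_distrib]
  exact Fintype.sum_equiv (Equiv.piComm _) _ _ (fun _ => rfl)

theorem seqOp_conjTranspose (A : ∀ l, Matrix (∀ k, X l k) (∀ k, X l k) ℂ) :
    (seqOp A)ᴴ = seqOp fun l => (A l)ᴴ := by
  ext a b
  simp [seqOp, Matrix.conjTranspose_apply]

theorem seqOp_smul (r : Fin L → ℝ) (A : ∀ l, Matrix (∀ k, X l k) (∀ k, X l k) ℂ) :
    seqOp (fun l => r l • A l) = (∏ l, r l) • seqOp A := by
  ext a b
  simp [seqOp, Finset.prod_mul_distrib]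

theorem seqOp_diagonal [∀ l k, DecidableEq (X l k)] (v : ∀ l, (∀ k, X l k) → ℂ) :
    seqOp (fun l => Matrix.diagonal (v l)) =
      Matrix.diagonal fun x => ∏ l, v l fun k => x k l := by
  have h_ext : ∀ x y : ∀ k l, X l k, (∀ l, (fun k => x k l) = fun k => y k l) ↔ x = y :=
    fun x y => by simpa only [funext_iff] using forall_comm
  ext x y
  simp only [seqOp, Matrix.of_apply, Matrix.diagonal_apply, Fintype.prod_ite_zero, h_ext]

theorem seqOp_one [∀ l k, DecidableEq (X l k)] :
    seqOp (fun l => (1 : Matrix (∀ k, X l k) (∀ k, X l k) ℂ)) = 1 := by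
  simp only [← Matrix.diagonal_one, seqOp_diagonal, Finset.prod_const_one]

theorem sum_seqOp {Ω : Fin L → Type} [∀ l, Fintype (Ω l)]
    (M : ∀ l, Ω l → Matrix (∀ k, X l k) (∀ k, X l k) ℂ) :
    ∑ c : ∀ l, Ω l, seqOp (fun l => M l (c l)) = seqOp fun l => ∑ i, M l i := by
  classical
  ext a b
  simp only [seqOp, Matrix.sum_apply, Matrix.of_apply, Finset.prod_univ_sum,
    Fintype.piFinset_univ]

theorem IsMeasurement.seq [∀ l k, Fintype (X l k)] [∀ l k, DecidableEq (X l k)]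
    {Ω : Fin L → Type} [∀ l, Fintype (Ω l)]
    {M : ∀ l, Ω l → Matrix (∀ k, X l k) (∀ k, X l k) ℂ} (hM : ∀ l, IsMeasurement (M l)) :
    IsMeasurement fun c : ∀ l, Ω l => seqOp fun l => M l (c l) := by
  refine ⟨fun c => seqOp_posSemidef _ fun l => (hM l).1 (c l), ?_⟩
  rw [sum_seqOp]
  simp only [(hM _).2, seqOp_one]

theorem IsHermitianPartialIsometry.seqOp [∀ l k, Fintype (X l k)]
    {W : ∀ l, Matrix (∀ k, X l k) (∀ k, X l k) ℂ}
    (hW : ∀ l, IsHermitianPartialIsometry (W l)) :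
    IsHermitianPartialIsometry (SeqDisc.seqOp W) where
  isHermitian := by
    rw [Matrix.IsHermitian, seqOp_conjTranspose]
    simp only [(hW _).isHermitian.eq]
  mul_mul_self := by simp only [seqOp_mul, (hW _).mul_mul_self]

end SequenceOperators

section PartialTransposition

variable {m : ℕ} {X : Fin m → Type}

/-- The partial transpose of `A` with respect to the tensor factor of party `k`. -/
def partialTranspose (k : Fin m) (A : Matrix (∀ k, X k) (∀ k, X k) ℂ) :
    Matrix (∀ k, X k) (∀ k, X k) ℂ :=
  Matrix.of fun a b => A (Function.update a k (b k)) (Function.update b k (a k))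

theorem partialTranspose_sum {ι : Type*} (k : Fin m) (s : Finset ι)
    (A : ι → Matrix (∀ k, X k) (∀ k, X k) ℂ) :
    partialTranspose k (∑ i ∈ s, A i) = ∑ i ∈ s, partialTranspose k (A i) := by
  ext a b
  simp only [partialTranspose, Matrix.of_apply, Matrix.sum_apply]

theorem partialTranspose_single [∀ k, DecidableEq (X k)] (k : Fin m) (x y : ∀ k, X k) (c : ℂ) :
    partialTranspose k (Matrix.single x y c) =
      Matrix.single (Function.update x k (y k)) (Function.update y k (x k)) c := by
  ext a b
  simp only [partialTranspose, Matrix.of_apply, Matrix.single_apply, Function.eq_update_iff,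
    Function.update_eq_iff]
  grind

theorem partialTranspose_diagonal [∀ k, DecidableEq (X k)] (k : Fin m) (v : (∀ k, X k) → ℂ) :
    partialTranspose k (Matrix.diagonal v) = Matrix.diagonal v := by
  ext a b
  by_cases hab : a = b
  · simp [partialTranspose, hab]
  · have h_ne : Function.update a k (b k) ≠ Function.update b k (a k) := fun h => hab <| by
      ext j
      grind [congrFun h j]
    simp [partialTranspose, hab, h_ne]

theorem partialTranspose_one [∀ k, DecidableEq (X k)] (k : Fin m) :
    partialTranspose k (1 : Matrix (∀ k, X k) (∀ k, X k) ℂ) = 1 := by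
  rw [← Matrix.diagonal_one, partialTranspose_diagonal]

theorem partialTranspose_prodOp (k : Fin m) (F : ∀ k, Matrix (X k) (X k) ℂ) :
    partialTranspose k (prodOp F) = prodOp (Function.update F k (F k)ᵀ) := by
  ext a b
  simp only [partialTranspose, prodOp, Matrix.of_apply]
  refine Finset.prod_congr rfl fun j _ => ?_
  by_cases hj : j = k
  · subst hj
    simp
  · simp [hj]

theorem partialTranspose_seqOp {L : ℕ} {X : Fin L → Fin m → Type} (k : Fin m)
    (A : ∀ l, Matrix (∀ k, X l k) (∀ k, X l k) ℂ) :
    partialTranspose k (seqOp A) = seqOp fun l => partialTranspose k (A l) := by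
  have h_update : ∀ (x y : ∀ k l, X l k) (l : Fin L),
      (fun j => Function.update x k (y k) j l) =
        Function.update (fun j => x j l) k (y k l) := fun x y l =>
    funext fun j => Function.apply_update (fun _ g => g l) x k (y k) j
  ext a b
  simp only [partialTranspose, seqOp, Matrix.of_apply, h_update]

theorem trace_partialTranspose_mul [∀ k, Fintype (X k)] (k : Fin m)
    (A B : Matrix (∀ k, X k) (∀ k, X k) ℂ) :
    (partialTranspose k A * partialTranspose k B).trace = (A * B).trace := by
  let swap : (∀ k, X k) × (∀ k, X k) → (∀ k, X k) × (∀ k, X k) := fun p =>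
    (Function.update p.1 k (p.2 k), Function.update p.2 k (p.1 k))
  have h_swap : swap.Involutive := fun p => by simp [swap]
  simp only [Matrix.trace, Matrix.diag_apply, Matrix.mul_apply, ← Fintype.sum_prod_type']
  exact Fintype.sum_equiv h_swap.toPerm _ _ fun _ => rfl

end PartialTransposition

section Separable

variable {m : ℕ} {X Y : Fin m → Type} [∀ k, Fintype (X k)] [∀ k, Fintype (Y k)]

theorem isSepOp_prodOp {F : ∀ k, Matrix (X k) (X k) ℂ} (hF : ∀ k, (F k).PosSemidef) :
    IsSepOp (prodOp F) :=
  ⟨1, fun _ => F, fun _ => hF, by simp⟩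

theorem isSepOp_one [∀ k, DecidableEq (X k)] :
    IsSepOp (1 : Matrix (∀ k, X k) (∀ k, X k) ℂ) :=
  prodOp_one (X := X) ▸ isSepOp_prodOp fun _ => Matrix.PosSemidef.one

theorem isSepOp_zero : IsSepOp (0 : Matrix (∀ k, X k) (∀ k, X k) ℂ) :=
  ⟨0, fun s => s.elim0, fun s => s.elim0, by simp⟩

namespace IsSepOp

theorem add {A B : Matrix (∀ k, X k) (∀ k, X k) ℂ} (hA : IsSepOp A) (hB : IsSepOp B) :
    IsSepOp (A + B) := by
  obtain ⟨r, F, hF, rfl⟩ := hA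
  obtain ⟨s, G, hG, rfl⟩ := hB
  refine ⟨r + s, Fin.append F G, fun i => ?_, by simp [Fin.sum_univ_add]⟩
  induction i using Fin.addCases with
  | left i => simpa using hF i
  | right i => simpa using hG i

theorem sum {ι : Type*} (s : Finset ι) {A : ι → Matrix (∀ k, X k) (∀ k, X k) ℂ}
    (hA : ∀ i ∈ s, IsSepOp (A i)) : IsSepOp (∑ i ∈ s, A i) :=
  Finset.sum_induction A IsSepOp (fun _ _ => add) isSepOp_zero hA

theorem smul {A : Matrix (∀ k, X k) (∀ k, X k) ℂ} (hA : IsSepOp A) (k : Fin m) {r : ℝ}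
    (hr : 0 ≤ r) : IsSepOp (r • A) := by
  obtain ⟨n, F, hF, rfl⟩ := hA
  refine ⟨n, fun s j => (Pi.mulSingle k r : Fin m → ℝ) j • F s j,
    fun s j => (hF s j).smul ?_, ?_⟩
  · by_cases hj : j = k <;> simp [hj, hr]
  · simp only [prodOp_smul, Fintype.prod_pi_mulSingle', Finset.smul_sum]

theorem conj {N : Matrix (∀ k, Y k) (∀ k, Y k) ℂ} (hN : IsSepOp N)
    (B : ∀ k, Matrix (Y k) (X k) ℂ) : IsSepOp ((prodOp B)ᴴ * N * prodOp B) := by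
  obtain ⟨r, F, hF, rfl⟩ := hN
  refine ⟨r, fun s k => (B k)ᴴ * F s k * B k,
    fun s k => (hF s k).conjTranspose_mul_mul_same (B k), ?_⟩
  rw [Matrix.mul_sum, Matrix.sum_mul]
  simp only [prodOp_conjTranspose, prodOp_mul]

theorem posSemidef_partialTranspose {A : Matrix (∀ k, X k) (∀ k, X k) ℂ} (hA : IsSepOp A)
    (k : Fin m) : (partialTranspose k A).PosSemidef := by
  obtain ⟨r, F, hF, rfl⟩ := hA
  rw [partialTranspose_sum]
  refine Matrix.posSemidef_sum _ fun s _ => ?_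
  rw [partialTranspose_prodOp]
  refine prodOp_posSemidef fun j => ?_
  by_cases hj : j = k
  · subst hj
    simpa using (hF s j).transpose
  · simpa [hj] using hF s j

theorem trace_mul_le {A σ : Matrix (∀ k, X k) (∀ k, X k) ℂ} (hσ : IsSepOp σ) {k : Fin m}
    (hA : IsHermitianPartialIsometry (partialTranspose k A)) :
    (A * σ).trace.re ≤ σ.trace.re := by
  classical
  have h_trace : (partialTranspose k σ).trace = σ.trace := by
    simpa only [partialTranspose_one, one_mul] using trace_partialTranspose_mul k 1 σ
  have h_nonneg := trace_mul_nonneg hA.posSemidef_one_sub (hσ.posSemidef_partialTranspose k)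
  rw [sub_mul, one_mul, Matrix.trace_sub, trace_partialTranspose_mul, h_trace] at h_nonneg
  simpa using (Complex.le_def.mp h_nonneg).1

end IsSepOp

theorem IsLOCC.isSepOp {Ω : Type} [DecidableEq Ω] [∀ k, DecidableEq (X k)]
    {M : Ω → Matrix (∀ k, X k) (∀ k, X k) ℂ} (hM : IsLOCC X M) (i : Ω) : IsSepOp (M i) := by
  induction hM with
  | guess X o =>
    dsimp only
    split_ifs
    · exact isSepOp_one
    · exact isSepOp_zero
  | round X _ r Y B _ _ N _ ih => exact IsSepOp.sum _ fun a _ => (ih a).conj (B a)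

end Separable

section BasisMeasurement

variable {m : ℕ} {X : Fin m → Type} [∀ k, Fintype (X k)] [∀ k, DecidableEq (X k)]
  {Ω : Type} [DecidableEq Ω]

theorem IsLOCC.localMeasurement {ι : Type*} [Fintype ι] (k : Fin m)
    {K : ι → Matrix (X k) (X k) ℂ} (hK : ∑ a, (K a)ᴴ * K a = 1)
    {N : ι → Ω → Matrix (∀ k, X k) (∀ k, X k) ℂ} (hN : ∀ a, IsLOCC X (N a)) :
    IsLOCC X fun i => ∑ a, (localOp k (K a))ᴴ * N a i * localOp k (K a) := by
  let e := (Fintype.equivFin ι).symm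
  have h_round := IsLOCC.round X k (Fintype.card ι) (fun _ => X)
    (fun a => Function.update (fun _ => 1) k (K (e a)))
    (by simpa only [Function.update_self, Equiv.sum_comp e fun a => (K a)ᴴ * K a] using hK)
    (fun a j hj => by simp [hj]) (fun a => N (e a)) fun a => hN (e a)
  convert h_round using 2 with i
  exact (Equiv.sum_comp e fun a => (localOp k (K a))ᴴ * N a i * localOp k (K a)).symm

/-- The measurement of every party in the computational basis, followed by the classical
processing `f` of the results. -/
def basisMeas (f : (∀ k, X k) → Ω) (i : Ω) : Matrix (∀ k, X k) (∀ k, X k) ℂ :=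
  Matrix.diagonal fun x => if f x = i then 1 else 0

theorem isStarProjection_basisMeas (f : (∀ k, X k) → Ω) (i : Ω) :
    IsStarProjection (basisMeas f i) :=
  isStarProjection_diagonal_ite _

theorem basisMeas_eq_sum (f : (∀ k, X k) → Ω) (i : Ω) :
    basisMeas f i = ∑ x with f x = i, prodOp fun k => Matrix.single (x k) (x k) (1 : ℂ) := by
  simp only [prodOp_single, Finset.prod_const_one, basisMeas]
  rw [← Matrix.sum_single_eq_diagonal, Finset.sum_filter]
  refine Finset.sum_congr rfl fun x _ => ?_
  split_ifs <;> simp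

theorem isMeasurement_basisMeas [Fintype Ω] (f : (∀ k, X k) → Ω) :
    IsMeasurement (basisMeas f) := by
  refine ⟨fun i => posSemidef_of_isStarProjection (isStarProjection_basisMeas f i), ?_⟩
  simp only [basisMeas, ← Matrix.diagonalAddMonoidHom_apply, ← map_sum]
  simp only [Matrix.diagonalAddMonoidHom_apply, ← Matrix.diagonal_one]
  congr 1
  ext x
  simp

theorem isLOCC_basisMeas_of_dependsOn [Nonempty (∀ k, X k)] (S : Finset (Fin m))
    (f : (∀ k, X k) → Ω) (hf : DependsOn f S) :
    IsLOCC X (basisMeas f) := by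
  induction S using Finset.induction_on generalizing f with
  | empty =>
    obtain ⟨x₀⟩ := ‹Nonempty (∀ k, X k)›
    have h_guess : basisMeas f = fun i => if i = f x₀ then 1 else 0 := by
      funext i
      have h_const : ∀ x, f x = f x₀ := fun x => hf (by simp)
      simp only [basisMeas, h_const, eq_comm (a := i)]
      split_ifs <;> simp
    rw [h_guess]
    exact IsLOCC.guess X (f x₀)
  | insert k S _ ih =>
    have h_kraus : ∑ a : X k, (Matrix.single a a (1 : ℂ))ᴴ * Matrix.single a a 1 = 1 := by
      simp [Matrix.sum_single_one]
    have h_next : ∀ a : X k, IsLOCC X (basisMeas fun x => f (Function.update x k a)) := fun a =>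
      ih _ fun x y hxy => hf fun j hj => by
        by_cases hjk : j = k
        · subst hjk
          simp
        · simpa [hjk] using hxy j (by simpa [hjk] using hj)
    convert IsLOCC.localMeasurement k h_kraus h_next using 2 with i
    simp only [← Matrix.diagonal_single, localOp_diagonal, basisMeas,
      Matrix.diagonal_conjTranspose, Matrix.diagonal_mul_diagonal]
    simp only [← Matrix.diagonalAddMonoidHom_apply, ← map_sum]
    congr 1
    ext x
    rw [Finset.sum_apply, Finset.sum_eq_single (x k)]
    · simp
    · intro a _ ha
      simp [ha.symm]
    · simp

theorem isLOCC_basisMeas [Nonempty (∀ k, X k)] (f : (∀ k, X k) → Ω) : IsLOCC X (basisMeas f) :=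
  isLOCC_basisMeas_of_dependsOn Finset.univ f (by simpa using dependsOn_univ f)

theorem seqOp_basisMeas {L : ℕ} {X : Fin L → Fin m → Type} [∀ l k, DecidableEq (X l k)]
    {Ω : Fin L → Type} [∀ l, DecidableEq (Ω l)] (f : ∀ l, (∀ k, X l k) → Ω l) (c : ∀ l, Ω l) :
    seqOp (fun l => basisMeas (f l) (c l)) =
      basisMeas (fun (x : ∀ k l, X l k) l => f l fun k => x k l) c := by
  simp only [basisMeas, seqOp_diagonal, Fintype.prod_ite_zero, Finset.prod_const_one, funext_iff]

end BasisMeasurement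

theorem IsSepOp.posSemidef {m : ℕ} {X : Fin m → Type} [∀ k, Fintype (X k)]
    {A : Matrix (∀ k, X k) (∀ k, X k) ℂ} (hA : IsSepOp A) : A.PosSemidef := by
  obtain ⟨r, F, hF, rfl⟩ := hA
  exact Matrix.posSemidef_sum _ fun s _ => prodOp_posSemidef (hF s)

theorem IsBlockPositive.trace_mul_nonneg {m : ℕ} {X : Fin m → Type} [∀ k, Fintype (X k)]
    {E σ : Matrix (∀ k, X k) (∀ k, X k) ℂ} (hE : IsBlockPositive E) (hσ : IsSepOp σ)
    (k : Fin m) : 0 ≤ (E * σ).trace.re := by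
  obtain h_zero | h_ne := eq_or_ne σ.trace 0
  · simp [hσ.posSemidef.trace_eq_zero_iff.mp h_zero]
  · have h_real : σ.trace = (σ.trace.re : ℂ) := Complex.eq_re_of_ofReal_le (r := 0) <| by
      simpa using hσ.posSemidef.trace_nonneg
    have h_pos : 0 < σ.trace.re :=
      (Complex.le_def.mp hσ.posSemidef.trace_nonneg).1.lt_of_ne fun h =>
        h_ne <| by rw [h_real, ← h, Complex.zero_re, Complex.ofReal_zero]
    have h_normalized := hE.2 _ (hσ.smul k (inv_nonneg.mpr h_pos.le)) <| by
      rw [Matrix.trace_smul, Complex.real_smul, h_real, Complex.ofReal_re, Complex.ofReal_inv,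
        inv_mul_cancel₀ (Complex.ofReal_ne_zero.mpr h_pos.ne')]
    rw [Matrix.mul_smul, Matrix.trace_smul, Complex.smul_re, smul_eq_mul] at h_normalized
    exact nonneg_of_mul_nonneg_right h_normalized (inv_pos.mpr h_pos)

namespace Ensemble

section Optimality

variable {m : ℕ} {X : Fin m → Type} [∀ k, Fintype (X k)] {Ω : Type} [Fintype Ω]
  {E : Ensemble X Ω} {M N : Ω → Matrix (∀ k, X k) (∀ k, X k) ℂ}

/-- The optimality conditions for the discrimination of `E` by separable measurements, in the
spirit of semidefinite duality: `H` is a feasible point of the dual problem, in which the operators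
`H - η i • ρ i` are block positive, and `M` satisfies complementary slackness. -/
structure IsOptimalityCertificate (E : Ensemble X Ω) (M : Ω → Matrix (∀ k, X k) (∀ k, X k) ℂ)
    (H : Matrix (∀ k, X k) (∀ k, X k) ℂ) : Prop where
  isBlockPositive : ∀ i, IsBlockPositive (H - E.η i • E.ρ i)
  trace_mul_eq_zero : ∀ i, (M i * (H - E.η i • E.ρ i)).trace = 0

/-- A sufficient condition for the optimality of `M` with the dual point `H = h • 1`: the operators
`A i = h⁻¹ • η i • ρ i` are partial transposes of Hermitian partial isometries, and `M i` is
supported where `A i` acts as the identity. In contrast to block positivity, this condition is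
inherited by sequences. -/
structure IsPartialTransposeCertificate (E : Ensemble X Ω)
    (M A : Ω → Matrix (∀ k, X k) (∀ k, X k) ℂ) (k : Fin m) (h : ℝ) : Prop where
  nonneg : 0 ≤ h
  smul_eq : ∀ i, E.η i • E.ρ i = h • A i
  isHermitianPartialIsometry : ∀ i, IsHermitianPartialIsometry (partialTranspose k (A i))
  mul_eq : ∀ i, M i * A i = M i

theorem IsPartialTransposeCertificate.success_eq
    {A : Ω → Matrix (∀ k, X k) (∀ k, X k) ℂ} {k : Fin m} {h : ℝ}
    (hE : E.IsPartialTransposeCertificate M A k h)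
    (N : Ω → Matrix (∀ k, X k) (∀ k, X k) ℂ) :
    E.success N = h * ∑ i, (A i * N i).trace.re := by
  rw [success, Finset.mul_sum]
  refine Finset.sum_congr rfl fun i _ => ?_
  simpa [Matrix.smul_mul, Matrix.trace_smul] using
    congrArg (fun B => (B * N i).trace.re) (hE.smul_eq i)

variable [∀ k, DecidableEq (X k)]

theorem success_le_one (hM : IsMeasurement M) : E.success M ≤ 1 := by
  classical
  rw [← E.η_sum]
  refine Finset.sum_le_sum fun i _ => mul_le_of_le_one_right (E.η_pos i).le ?_
  have h_compl : (1 - M i).PosSemidef := by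
    rw [← hM.2, ← Finset.add_sum_erase _ _ (Finset.mem_univ i), add_sub_cancel_left]
    exact Matrix.posSemidef_sum _ fun j _ => hM.1 j
  have h_trace := trace_mul_nonneg (E.ρ_posSemidef i) h_compl
  rw [Matrix.mul_sub, Matrix.mul_one, Matrix.trace_sub, E.ρ_trace] at h_trace
  simpa using (Complex.le_def.mp h_trace).1

theorem success_le_pG (hM : IsMeasurement M) : E.success M ≤ E.pG :=
  le_csSup ⟨1, by rintro p ⟨N, hN, rfl⟩; exact success_le_one hN⟩ ⟨M, hM, rfl⟩

theorem success_add_sum_trace (hM : IsMeasurement M) (H : Matrix (∀ k, X k) (∀ k, X k) ℂ) :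
    E.success M + ∑ i, ((H - E.η i • E.ρ i) * M i).trace.re = H.trace.re := by
  have h_term : ∀ i, E.η i * (E.ρ i * M i).trace.re + ((H - E.η i • E.ρ i) * M i).trace.re =
      (H * M i).trace.re := fun i => by
    simp [Matrix.sub_mul, Matrix.trace_sub, Matrix.trace_smul]
  rw [success, ← Finset.sum_add_distrib, Finset.sum_congr rfl fun i _ => h_term i,
    ← Complex.re_sum, ← Matrix.trace_sum, ← Matrix.mul_sum, hM.2, Matrix.mul_one]

namespace IsOptimalityCertificate

variable {H : Matrix (∀ k, X k) (∀ k, X k) ℂ}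

theorem success_eq_trace (h : E.IsOptimalityCertificate M H) (hM : IsMeasurement M) :
    E.success M = H.trace.re := by
  have h_slack : ∀ i, ((H - E.η i • E.ρ i) * M i).trace.re = 0 := fun i => by
    rw [Matrix.trace_mul_comm, h.trace_mul_eq_zero, Complex.zero_re]
  rw [← success_add_sum_trace (E := E) hM H, Finset.sum_eq_zero fun i _ => h_slack i, add_zero]

theorem success_le (h : E.IsOptimalityCertificate M H) (k : Fin m) (hM : IsMeasurement M)
    (hN : IsMeasurement N) (hN_sep : ∀ i, IsSepOp (N i)) : E.success N ≤ E.success M := by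
  rw [h.success_eq_trace hM, ← success_add_sum_trace (E := E) hN H]
  exact le_add_of_nonneg_right <| Finset.sum_nonneg fun i _ =>
    (h.isBlockPositive i).trace_mul_nonneg (hN_sep i) k

theorem pSEP_eq_success (h : E.IsOptimalityCertificate M H) (k : Fin m) (hM : IsMeasurement M)
    (hM_sep : ∀ i, IsSepOp (M i)) : E.pSEP = E.success M :=
  IsGreatest.csSup_eq ⟨⟨M, hM, hM_sep, rfl⟩, by
    rintro p ⟨N, hN, hN_sep, rfl⟩
    exact h.success_le k hM hN hN_sep⟩

theorem pL_eq_success [DecidableEq Ω] (h : E.IsOptimalityCertificate M H) (k : Fin m)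
    (hM : IsMeasurement M) (hM_locc : IsLOCC X M) : E.pL = E.success M :=
  IsGreatest.csSup_eq ⟨⟨M, hM, hM_locc, rfl⟩, by
    rintro p ⟨N, hN, hN_locc, rfl⟩
    exact h.success_le k hM hN hN_locc.isSepOp⟩

end IsOptimalityCertificate

namespace IsPartialTransposeCertificate

variable {A : Ω → Matrix (∀ k, X k) (∀ k, X k) ℂ} {k : Fin m} {h : ℝ}

theorem isOptimalityCertificate (hE : E.IsPartialTransposeCertificate M A k h) :
    E.IsOptimalityCertificate M (h • 1) where
  isBlockPositive i := by
    refine ⟨?_, fun σ hσ h_trace => ?_⟩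
    · exact (Matrix.isHermitian_one.smul (IsSelfAdjoint.all h)).sub
        ((E.ρ_posSemidef i).isHermitian.smul (IsSelfAdjoint.all (E.η i)))
    · have h_le := hσ.trace_mul_le (hE.isHermitianPartialIsometry i)
      rw [h_trace, Complex.one_re] at h_le
      rw [hE.smul_eq, ← smul_sub, Matrix.smul_mul, Matrix.sub_mul, Matrix.one_mul,
        Matrix.trace_smul, Matrix.trace_sub, h_trace]
      simpa using mul_nonneg hE.nonneg (sub_nonneg.mpr h_le)
  trace_mul_eq_zero i := by
    rw [hE.smul_eq, ← smul_sub, Matrix.mul_smul, Matrix.mul_sub, Matrix.mul_one, hE.mul_eq,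
      sub_self, smul_zero, Matrix.trace_zero]

end IsPartialTransposeCertificate

end Optimality

section Sequences

variable {m L : ℕ} {X : Fin L → Fin m → Type} [∀ l k, Fintype (X l k)]
  {Ω : Fin L → Type} [∀ l, Fintype (Ω l)] {E : ∀ l, Ensemble (X l) (Ω l)}
  {M A : ∀ l, Ω l → Matrix (∀ k, X l k) (∀ k, X l k) ℂ}

theorem seq_success (hM : ∀ l i, (M l i).PosSemidef) :
    (seq E).success (fun c => seqOp fun l => M l (c l)) = ∏ l, (E l).success (M l) := by
  classical
  have h_real : ∀ l i, ((E l).ρ i * M l i).trace = (((E l).ρ i * M l i).trace.re : ℂ) :=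
    fun l i => Complex.eq_re_of_ofReal_le (r := 0) <| by
      simpa using trace_mul_nonneg ((E l).ρ_posSemidef i) (hM l i)
  simp only [success, seq, seqOp_mul, seqOp_trace, Finset.prod_univ_sum, Fintype.piFinset_univ,
    Finset.prod_mul_distrib]
  refine Finset.sum_congr rfl fun c _ => ?_
  rw [Finset.prod_congr rfl fun l _ => h_real l (c l), ← Complex.ofReal_prod, Complex.ofReal_re]

theorem IsPartialTransposeCertificate.seq {k : Fin m} {h : Fin L → ℝ}
    (hE : ∀ l, (E l).IsPartialTransposeCertificate (M l) (A l) k (h l)) :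
    (seq E).IsPartialTransposeCertificate (fun c => seqOp fun l => M l (c l))
      (fun c => seqOp fun l => A l (c l)) k (∏ l, h l) where
  nonneg := Finset.prod_nonneg fun l _ => (hE l).nonneg
  smul_eq c := by simp only [Ensemble.seq, ← seqOp_smul, (hE _).smul_eq]
  isHermitianPartialIsometry c := by
    rw [partialTranspose_seqOp]
    exact IsHermitianPartialIsometry.seqOp fun l => (hE l).isHermitianPartialIsometry (c l)
  mul_eq c := by simp only [seqOp_mul, (hE _).mul_eq]

variable [∀ l k, DecidableEq (X l k)]

theorem prod_success_le_pG_seq (hM : ∀ l, IsMeasurement (M l)) :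
    ∏ l, (E l).success (M l) ≤ (seq E).pG :=
  (seq_success fun l => (hM l).1).symm.trans_le (success_le_pG (IsMeasurement.seq hM))

theorem IsPartialTransposeCertificate.factorizable [∀ l, DecidableEq (Ω l)] {k : Fin m}
    {h : Fin L → ℝ} (hE : ∀ l, (E l).IsPartialTransposeCertificate (M l) (A l) k (h l))
    (hM : ∀ l, IsMeasurement (M l)) (hM_locc : ∀ l, IsLOCC (X l) (M l))
    (hM_seq : IsLOCC (fun k => ∀ l, X l k) fun c : ∀ l, Ω l => seqOp fun l => M l (c l)) :
    Factorizable E := by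
  rw [Factorizable,
    (IsPartialTransposeCertificate.seq hE).isOptimalityCertificate.pL_eq_success k
      (IsMeasurement.seq hM) hM_seq,
    seq_success fun l => (hM l).1]
  exact Finset.prod_congr rfl fun l _ =>
    ((hE l).isOptimalityCertificate.pL_eq_success k (hM l) (hM_locc l)).symm

end Sequences

end Ensemble

section ComputationalBasis

variable {m d : ℕ}

theorem star_diagKet (i : Fin d) : star (diagKet m d i) = diagKet m d i := by
  rw [diagKet, ← Pi.single_star, star_one]

theorem Psi_eq_single (i : Fin d) :
    Psi m d i = Matrix.single (fun _ => i) (fun _ => i) 1 := by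
  rw [Psi, star_diagKet, diagKet, Matrix.single_eq_single_vecMulVec_single]

/-- The outcome announced after the results `x` of the computational-basis measurements: `j` if all
parties obtain `j`, and `d` if the results do not agree. -/
def exLabel (hm : 2 ≤ m) (x : Fin m → Fin d) : Fin (d + 2) :=
  if x = fun _ => x ⟨0, by omega⟩ then (x ⟨0, by omega⟩).castSucc.castSucc
  else (Fin.last d).castSucc

theorem exLabel_eq_castSucc_castSucc_iff (hm : 2 ≤ m) (x : Fin m → Fin d) (j : Fin d) :
    exLabel hm x = j.castSucc.castSucc ↔ x = fun _ => j := by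
  unfold exLabel
  split_ifs with hx
  · rw [Fin.castSucc_inj, Fin.castSucc_inj]
    exact ⟨fun h => h ▸ hx, fun h => by rw [h]⟩
  · rw [Fin.castSucc_inj]
    exact iff_of_false (Fin.castSucc_ne_last j).symm fun h => hx (by rw [h])

theorem exLabel_eq_castSucc_last_iff (hm : 2 ≤ m) (x : Fin m → Fin d) :
    exLabel hm x = (Fin.last d).castSucc ↔ ¬∃ j, x = fun _ => j := by
  have h_const : (∃ j, x = fun _ => j) ↔ x = fun _ => x ⟨0, by omega⟩ :=
    ⟨fun ⟨j, hj⟩ => by rw [hj], fun h => ⟨_, h⟩⟩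
  rw [h_const]
  unfold exLabel
  split_ifs with hx
  · simpa using hx
  · simpa using hx

theorem exLabel_ne_last (hm : 2 ≤ m) (x : Fin m → Fin d) : exLabel hm x ≠ Fin.last (d + 1) := by
  unfold exLabel
  split_ifs <;> exact Fin.castSucc_ne_last _

theorem exMeas_eq_basisMeas (hm : 2 ≤ m) : exMeas m d = basisMeas (exLabel hm) := by
  funext i
  induction i using Fin.lastCases with
  | last => simp [exMeas, basisMeas, exLabel_ne_last]
  | cast i =>
    induction i using Fin.lastCases with
    | last =>
      have h_meas : exMeas m d (Fin.last d).castSucc = 1 - ∑ j, Psi m d j := by simp [exMeas]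
      rw [h_meas, basisMeas, sum_Psi_eq hm, ← Matrix.diagonal_one, Matrix.diagonal_sub]
      congr 1
      ext x
      by_cases hx : ∃ j, x = fun _ => j <;> simp [exLabel_eq_castSucc_last_iff, hx]
    | cast j =>
      have h_meas : exMeas m d j.castSucc.castSucc = Psi m d j := by simp [exMeas]
      rw [h_meas, basisMeas, Psi_eq_single, ← Matrix.diagonal_single]
      congr 1
      ext x
      rw [Pi.single_apply]
      exact if_congr (exLabel_eq_castSucc_castSucc_iff hm x j).symm rfl rfl

theorem exSeqMeas_eq_basisMeas (hm : 2 ≤ m) (L : ℕ) :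
    exSeqMeas m d L = basisMeas (X := fun _ : Fin m => Fin L → Fin d)
      fun x l => exLabel hm fun k => x k l := by
  funext c
  simp only [exSeqMeas, exMeas_eq_basisMeas hm]
  exact seqOp_basisMeas (X := fun _ _ => Fin d) (fun _ => exLabel hm) c

theorem isMeasurement_exMeas (hm : 2 ≤ m) : IsMeasurement (exMeas m d) :=
  exMeas_eq_basisMeas hm ▸ isMeasurement_basisMeas _

theorem isLOCC_exMeas (hm : 2 ≤ m) (hd : 2 ≤ d) :
    IsLOCC (fun _ : Fin m => Fin d) (exMeas m d) := by
  have : NeZero d := ⟨by omega⟩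
  exact exMeas_eq_basisMeas (d := d) hm ▸ isLOCC_basisMeas _

theorem isMeasurement_exSeqMeas (hm : 2 ≤ m) (L : ℕ) : IsMeasurement (exSeqMeas m d L) :=
  IsMeasurement.seq (X := fun _ _ => Fin d) fun _ => isMeasurement_exMeas hm

theorem isLOCC_exSeqMeas (hm : 2 ≤ m) (hd : 2 ≤ d) (L : ℕ) :
    IsLOCC (fun _ : Fin m => Fin L → Fin d) (exSeqMeas m d L) := by
  have : NeZero d := ⟨by omega⟩
  exact exSeqMeas_eq_basisMeas (d := d) hm L ▸ isLOCC_basisMeas _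

end ComputationalBasis

section GHZ

variable {m d : ℕ}

theorem smul_Phi_eq_sum_single (hd : d ≠ 0) :
    (d : ℝ) • Phi m d =
      ∑ p : Fin d × Fin d, Matrix.single (fun _ => p.1) (fun _ => p.2) 1 := by
  have h_norm : (d : ℝ) * ((1 / √(d : ℝ)) * (1 / √(d : ℝ))) = 1 := by
    have hd' : (0 : ℝ) < d := by positivity
    rw [div_mul_div_comm, Real.mul_self_sqrt hd'.le]
    field_simp
  have h_single : ∀ i j : Fin d, Matrix.single (fun _ : Fin m => i) (fun _ => j) (1 : ℂ) =
      Matrix.vecMulVec (diagKet m d i) (diagKet m d j) := fun i j => by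
    rw [Matrix.single_eq_single_vecMulVec_single, diagKet, diagKet]
  have h_outer : Matrix.vecMulVec (∑ i, diagKet m d i) (∑ j, diagKet m d j) =
      ∑ p : Fin d × Fin d, Matrix.single (fun _ => p.1) (fun _ => p.2) 1 := by
    ext x y
    simp only [h_single, Fintype.sum_prod_type, Matrix.sum_apply, Matrix.vecMulVec_apply,
      Finset.sum_apply, Finset.sum_mul_sum]
  rw [← h_outer, Phi, ghzKet, star_smul, star_sum]
  simp only [star_diagKet, Matrix.smul_vecMulVec, Matrix.vecMulVec_smul, ← Complex.coe_smul,
    smul_smul]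
  rw [Complex.star_def, Complex.conj_ofReal]
  convert one_smul ℂ _ using 2
  exact_mod_cast h_norm

theorem isStarProjection_Phi (hm : 2 ≤ m) (hd : 2 ≤ d) : IsStarProjection (Phi m d) where
  isIdempotentElem := by
    have h_trace := trace_Phi hm hd
    rw [Phi, Matrix.trace_vecMulVec, dotProduct_comm] at h_trace
    rw [IsIdempotentElem, Phi, Matrix.vecMulVec_mul_vecMulVec, h_trace, one_smul]
  isSelfAdjoint := (Matrix.posSemidef_vecMulVec_self_star _).isHermitian

theorem isStarProjection_sum_Psi (hm : 2 ≤ m) : IsStarProjection (∑ j, Psi m d j) :=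
  sum_Psi_eq (d := d) hm ▸ isStarProjection_diagonal_ite _

theorem sum_Psi_mul_Phi (hm : 2 ≤ m) : (∑ j, Psi m d j) * Phi m d = Phi m d := by
  rw [Phi, Matrix.mul_vecMulVec]
  congr 1
  rw [ghzKet, Matrix.mulVec_smul, Matrix.mulVec_sum, sum_Psi_eq hm]
  congr 1
  refine Finset.sum_congr rfl fun i _ => ?_
  rw [diagKet, Matrix.diagonal_mulVec_single, if_pos ⟨i, rfl⟩, mul_one]

/-- The `k`-th partial transpose of `d • Φ = ∑ᵢⱼ |i⋯i⟩⟨j⋯j|` permutes the basis vectors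
`|i⋯iji⋯i⟩` and annihilates the others. -/
theorem isHermitianPartialIsometry_partialTranspose_smul_Phi (hm : 2 ≤ m) (hd : d ≠ 0)
    (k : Fin m) :
    IsHermitianPartialIsometry (partialTranspose (X := fun _ => Fin d) k ((d : ℝ) • Phi m d)) := by
  let e : Fin d × Fin d → Fin m → Fin d := fun p => Function.update (fun _ => p.1) k p.2
  have he : e.Injective := fun p q hpq => by
    have : Nontrivial (Fin m) := Fin.nontrivial_iff_two_le.mpr hm
    obtain ⟨j, hj⟩ := exists_ne k
    exact Prod.ext (by simpa [e, hj] using congrFun hpq j) (by simpa [e] using congrFun hpq k)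
  have he_swap : (e ∘ Prod.swap).Injective := he.comp Prod.swap_injective
  have h_eq : partialTranspose (X := fun _ => Fin d) k ((d : ℝ) • Phi m d) =
      ∑ p, Matrix.single (e p) ((e ∘ Prod.swap) p) 1 := by
    rw [smul_Phi_eq_sum_single hd, partialTranspose_sum]
    simp only [partialTranspose_single]
    rfl
  have h_swap : ∑ p, Matrix.single (e p) ((e ∘ Prod.swap) p) (1 : ℂ) =
      ∑ p, Matrix.single ((e ∘ Prod.swap) p) (e p) 1 :=
    (Equiv.sum_comp (Equiv.prodComm _ _) _).symm
  rw [h_eq]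
  refine ⟨?_, ?_⟩
  · rw [Matrix.IsHermitian, Matrix.conjTranspose_sum]
    simp only [Matrix.conjTranspose_single, star_one]
    exact h_swap.symm
  · nth_rw 2 [h_swap]
    rw [sum_single_mul_sum_single he_swap, sum_single_mul_sum_single he]

end GHZ

section Example

variable {m d : ℕ}

/-- The operators `(d^m + d) η_i ρ_i`. -/
noncomputable def exWeighted (m d : ℕ) (i : Fin (d + 2)) :
    Matrix (Fin m → Fin d) (Fin m → Fin d) ℂ :=
  if i = Fin.last (d + 1) then (d : ℝ) • Phi m d else exMeas m d i

theorem exProb_smul_exState (hm : 2 ≤ m) (hd : 2 ≤ d) (i : Fin (d + 2)) :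
    exProb m d i • exState m d i = (1 / ((d : ℝ) ^ m + d)) • exWeighted m d i := by
  have h_ne : (d : ℝ) ^ m - d ≠ 0 := (sub_pos.mpr (lt_pow_of_two_le hm hd)).ne'
  induction i using Fin.lastCases with
  | last =>
    simp only [exProb, exState, exWeighted, Fin.val_last, if_true]
    simp [smul_smul, div_eq_inv_mul]
  | cast i =>
    induction i using Fin.lastCases with
    | last =>
      simp [exProb, exState, exWeighted, exMeas, smul_smul, Fin.castSucc_ne_last]
      field_simp
    | cast j => simp [exProb, exState, exWeighted, exMeas, Fin.castSucc_ne_last]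

theorem exMeas_mul_exWeighted (hm : 2 ≤ m) (i : Fin (d + 2)) :
    exMeas m d i * exWeighted m d i = exMeas m d i := by
  unfold exWeighted
  split_ifs with hi
  · simp [hi, exMeas]
  · rw [exMeas_eq_basisMeas hm]
    exact (isStarProjection_basisMeas _ i).isIdempotentElem

theorem isHermitianPartialIsometry_partialTranspose_exWeighted (hm : 2 ≤ m) (hd : d ≠ 0)
    (k : Fin m) (i : Fin (d + 2)) :
    IsHermitianPartialIsometry
      (partialTranspose (X := fun _ => Fin d) k (exWeighted m d i)) := by
  unfold exWeighted
  split_ifs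
  · exact isHermitianPartialIsometry_partialTranspose_smul_Phi hm hd k
  · rw [exMeas_eq_basisMeas hm, basisMeas, partialTranspose_diagonal]
    exact .of_isStarProjection (isStarProjection_diagonal_ite _)

theorem exEnsemble_isPartialTransposeCertificate (hm : 2 ≤ m) (hd : 2 ≤ d) (k : Fin m) :
    (exEnsemble m d hm hd).IsPartialTransposeCertificate (exMeas m d) (exWeighted m d) k
      (1 / ((d : ℝ) ^ m + d)) where
  nonneg := by positivity
  smul_eq := exProb_smul_exState hm hd
  isHermitianPartialIsometry :=
    isHermitianPartialIsometry_partialTranspose_exWeighted hm (by omega) k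
  mul_eq := exMeas_mul_exWeighted hm

theorem exH_eq (L : ℕ) : exH m d L = (1 / ((d : ℝ) ^ m + d)) ^ L • 1 := by
  rw [exH, one_div_pow, seqOp_one (X := fun (_ : Fin L) (_ : Fin m) => Fin d)]

theorem isHermitian_exH (L : ℕ) : (exH m d L).IsHermitian :=
  exH_eq (m := m) (d := d) L ▸ Matrix.isHermitian_one.smul (IsSelfAdjoint.all _)

theorem exSeq_isOptimalityCertificate (hm : 2 ≤ m) (hd : 2 ≤ d) (L : ℕ) :
    (exSeq m d L hm hd).IsOptimalityCertificate (exSeqMeas m d L) (exH m d L) := by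
  have h := (Ensemble.IsPartialTransposeCertificate.seq fun _ : Fin L =>
    exEnsemble_isPartialTransposeCertificate hm hd ⟨0, by omega⟩).isOptimalityCertificate
  rwa [Fin.prod_const, ← exH_eq] at h

theorem success_exMeas (hm : 2 ≤ m) (hd : 2 ≤ d) :
    (exEnsemble m d hm hd).success (exMeas m d) = (d : ℝ) ^ m / ((d : ℝ) ^ m + d) := by
  have h := exEnsemble_isPartialTransposeCertificate hm hd ⟨0, by omega⟩
  rw [h.isOptimalityCertificate.success_eq_trace (isMeasurement_exMeas hm), Matrix.trace_smul,
    Matrix.trace_one, Complex.smul_re, Complex.natCast_re]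
  simp [div_eq_inv_mul]

theorem pL_exEnsemble (hm : 2 ≤ m) (hd : 2 ≤ d) :
    (exEnsemble m d hm hd).pL = (exEnsemble m d hm hd).success (exMeas m d) :=
  (exEnsemble_isPartialTransposeCertificate hm hd
    ⟨0, by omega⟩).isOptimalityCertificate.pL_eq_success ⟨0, by omega⟩
      (isMeasurement_exMeas hm) (isLOCC_exMeas hm hd)

theorem pL_exSeq (hm : 2 ≤ m) (hd : 2 ≤ d) (L : ℕ) :
    (exSeq m d L hm hd).pL = (exSeq m d L hm hd).success (exSeqMeas m d L) :=
  (exSeq_isOptimalityCertificate hm hd L).pL_eq_success ⟨0, by omega⟩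
    (isMeasurement_exSeqMeas hm L) (isLOCC_exSeqMeas hm hd L)

theorem pSEP_exSeq (hm : 2 ≤ m) (hd : 2 ≤ d) (L : ℕ) :
    (exSeq m d L hm hd).pSEP = (exSeq m d L hm hd).success (exSeqMeas m d L) :=
  (exSeq_isOptimalityCertificate hm hd L).pSEP_eq_success ⟨0, by omega⟩
    (isMeasurement_exSeqMeas hm L) (isLOCC_exSeqMeas hm hd L).isSepOp

theorem factorizable_exEnsemble (hm : 2 ≤ m) (hd : 2 ≤ d) (L : ℕ) :
    Factorizable fun _ : Fin L => exEnsemble m d hm hd :=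
  Ensemble.IsPartialTransposeCertificate.factorizable
    (fun _ => exEnsemble_isPartialTransposeCertificate hm hd ⟨0, by omega⟩)
    (fun _ => isMeasurement_exMeas hm) (fun _ => isLOCC_exMeas hm hd) (isLOCC_exSeqMeas hm hd L)

theorem not_isSepOp_Phi (hm : 2 ≤ m) (hd : 2 ≤ d) :
    ¬IsSepOp (X := fun _ : Fin m => Fin d) (Phi m d) := fun h_sep => by
  have h_le := h_sep.trace_mul_le
    (isHermitianPartialIsometry_partialTranspose_smul_Phi hm (by omega) ⟨0, by omega⟩)
  rw [Matrix.smul_mul, (isStarProjection_Phi hm hd).isIdempotentElem.eq, Matrix.trace_smul,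
    trace_Phi hm hd] at h_le
  have h_one : d ≤ 1 := by simpa using h_le
  omega

theorem isSepOp_exState_iff (hm : 2 ≤ m) (hd : 2 ≤ d) (i : Fin (d + 2)) :
    IsSepOp (X := fun _ : Fin m => Fin d) (exState m d i) ↔ i.val ≤ d := by
  have h_sep := (isLOCC_exMeas hm hd).isSepOp i
  have h_nonneg : 0 ≤ 1 / ((d : ℝ) ^ m - d) :=
    one_div_nonneg.mpr (sub_nonneg.mpr (lt_pow_of_two_le hm hd).le)
  unfold exMeas at h_sep
  unfold exState
  split_ifs at h_sep ⊢ with h_lt h_eq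
  · exact iff_of_true h_sep h_lt.le
  · exact iff_of_true (h_sep.smul ⟨0, by omega⟩ h_nonneg) h_eq.le
  · exact iff_of_false (not_isSepOp_Phi hm hd) (by omega)

/-- A global measurement that is better than every LOCC measurement: it detects `Φ`, and guesses one
of the labels of the `Ψ_j` at random if it finds the rest of their span. -/
noncomputable def exGlobalMeas (m d : ℕ) : Fin (d + 2) → Matrix (Fin m → Fin d) (Fin m → Fin d) ℂ :=
  Fin.snoc (Fin.snoc (fun _ => (1 / (d : ℝ)) • (∑ j, Psi m d j - Phi m d)) (1 - ∑ j, Psi m d j))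
    (Phi m d)

theorem isStarProjection_sum_Psi_sub_Phi (hm : 2 ≤ m) (hd : 2 ≤ d) :
    IsStarProjection (∑ j, Psi m d j - Phi m d) :=
  (isStarProjection_Phi hm hd).sub_of_mul_eq_right (isStarProjection_sum_Psi hm)
    (sum_Psi_mul_Phi hm)

theorem isMeasurement_exGlobalMeas (hm : 2 ≤ m) (hd : 2 ≤ d) :
    IsMeasurement (exGlobalMeas m d) := by
  refine ⟨fun i => ?_, ?_⟩
  · induction i using Fin.lastCases with
    | last =>
      simpa [exGlobalMeas] using posSemidef_of_isStarProjection (isStarProjection_Phi hm hd)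
    | cast i =>
      induction i using Fin.lastCases with
      | last => simpa [exGlobalMeas] using posSemidef_complement hm
      | cast j =>
        simpa [exGlobalMeas] using
          (posSemidef_of_isStarProjection (isStarProjection_sum_Psi_sub_Phi hm hd)).smul
            (inv_nonneg.mpr d.cast_nonneg)
  · have hd' : (d : ℝ) ≠ 0 := by positivity
    rw [Fin.sum_univ_castSucc, Fin.sum_univ_castSucc]
    simp only [exGlobalMeas, Fin.snoc_castSucc, Fin.snoc_last, Finset.sum_const,
      Finset.card_univ, Fintype.card_fin, ← Nat.cast_smul_eq_nsmul ℝ, smul_smul,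
      mul_one_div_cancel hd', one_smul]
    abel

theorem success_exGlobalMeas (hm : 2 ≤ m) (hd : 2 ≤ d) :
    (exEnsemble m d hm hd).success (exGlobalMeas m d) =
      ((d : ℝ) ^ m + (1 - 1 / d)) / ((d : ℝ) ^ m + d) := by
  have hd' : (d : ℝ) ≠ 0 := by positivity
  have h_diag : ∑ j : Fin d, (Psi m d j * ((1 / (d : ℝ)) • (∑ j, Psi m d j - Phi m d))).trace.re =
      1 - 1 / d := by
    rw [← Complex.re_sum, ← Matrix.trace_sum, ← Matrix.sum_mul, Matrix.mul_smul, Matrix.mul_sub,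
      (isStarProjection_sum_Psi hm).isIdempotentElem.eq, sum_Psi_mul_Phi hm, Matrix.trace_smul,
      Matrix.trace_sub, Matrix.trace_sum, trace_Phi hm hd]
    simp only [trace_Psi]
    simp
    field_simp
  have h_compl : ((1 - ∑ j, Psi m d j) * (1 - ∑ j, Psi m d j)).trace.re = (d : ℝ) ^ m - d := by
    rw [(isStarProjection_sum_Psi hm).one_sub.isIdempotentElem.eq, trace_complement,
      Complex.ofReal_re]
  have h_ghz : ((d : ℝ) • Phi m d * Phi m d).trace.re = d := by
    rw [Matrix.smul_mul, (isStarProjection_Phi hm hd).isIdempotentElem.eq, Matrix.trace_smul,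
      trace_Phi hm hd]
    simp
  rw [(exEnsemble_isPartialTransposeCertificate hm hd ⟨0, by omega⟩).success_eq,
    Fin.sum_univ_castSucc, Fin.sum_univ_castSucc]
  simp only [exWeighted, exMeas, exGlobalMeas, Fin.castSucc_ne_last, if_true, if_false,
    Fin.snoc_castSucc, Fin.snoc_last, Fin.val_castSucc, Fin.val_last, Fin.is_lt, dite_true,
    lt_irrefl, dite_false, Fin.eta, h_diag, h_compl, h_ghz]
  ring

theorem pL_exEnsemble_lt_success_exGlobalMeas (hm : 2 ≤ m) (hd : 2 ≤ d) :
    (exEnsemble m d hm hd).pL < (exEnsemble m d hm hd).success (exGlobalMeas m d) := by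
  rw [pL_exEnsemble, success_exMeas, success_exGlobalMeas]
  refine div_lt_div_of_pos_right (lt_add_of_pos_right _ (sub_pos.mpr ?_)) (by positivity)
  exact (div_lt_one (by positivity)).mpr (by exact_mod_cast hd)

theorem exProb_lt_pL (hm : 2 ≤ m) (hd : 2 ≤ d) (i : Fin (d + 2)) :
    exProb m d i < (exEnsemble m d hm hd).pL := by
  have h_lt := lt_pow_of_two_le hm hd
  have hd' : (2 : ℝ) ≤ d := by exact_mod_cast hd
  rw [pL_exEnsemble, success_exMeas]
  unfold exProb
  split_ifs <;> exact div_lt_div_of_pos_right (by linarith) (by positivity)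

theorem exSeq_η_lt_pL (hm : 2 ≤ m) (hd : 2 ≤ d) {L : ℕ} (hL : L ≠ 0)
    (c : Fin L → Fin (d + 2)) : (exSeq m d L hm hd).η c < (exSeq m d L hm hd).pL := by
  have : NeZero L := ⟨hL⟩
  calc (exSeq m d L hm hd).η c = ∏ l, exProb m d (c l) := rfl
    _ < ∏ _ : Fin L, (exEnsemble m d hm hd).pL :=
      Finset.prod_lt_prod_of_nonempty (fun l _ => (exEnsemble m d hm hd).η_pos (c l))
        (fun l _ => exProb_lt_pL hm hd (c l)) Finset.univ_nonempty
    _ = (exSeq m d L hm hd).pL := (factorizable_exEnsemble hm hd L).symm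

theorem pL_exSeq_lt_pG (hm : 2 ≤ m) (hd : 2 ≤ d) {L : ℕ} (hL : L ≠ 0) :
    (exSeq m d L hm hd).pL < (exSeq m d L hm hd).pG := by
  have : NeZero L := ⟨hL⟩
  have h_pos : 0 < (exEnsemble m d hm hd).pL :=
    ((exEnsemble m d hm hd).η_pos 0).trans (exProb_lt_pL hm hd 0)
  calc (exSeq m d L hm hd).pL = ∏ _ : Fin L, (exEnsemble m d hm hd).pL :=
      factorizable_exEnsemble hm hd L
    _ < ∏ _ : Fin L, (exEnsemble m d hm hd).success (exGlobalMeas m d) :=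
      Finset.prod_lt_prod_of_nonempty (fun _ _ => h_pos)
        (fun _ _ => pL_exEnsemble_lt_success_exGlobalMeas hm hd) Finset.univ_nonempty
    _ ≤ (exSeq m d L hm hd).pG :=
      Ensemble.prod_success_le_pG_seq fun _ => isMeasurement_exGlobalMeas hm hd

end Example

end SeqDisc

theorem mainTheorem8 (m d L : ℕ) (hm : 2 ≤ m) (hd : 2 ≤ d) (hL : 2 ≤ L) :
    -- the first `d + 1` states are separable, the last one is entangled
    (∀ i : Fin (d + 2), IsSepOp ((exEnsemble m d hm hd).ρ i) ↔ i.val ≤ d) ∧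
    -- the measurement of a single step consists of computational-basis measurements of the
    -- parties, followed by classical processing of the results
    (∃ f : (Fin m → Fin d) → Fin (d + 2), ∀ i : Fin (d + 2),
      exMeas m d i = ∑ x with f x = i,
        prodOp (X := fun _ => Fin d) (Y := fun _ => Fin d)
          fun k => Matrix.single (x k) (x k) 1) ∧
    -- it is an LOCC measurement, and so is its independent repetition
    (IsMeasurement (exMeas m d) ∧ IsLOCC (fun _ : Fin m => Fin d) (exMeas m d)) ∧
    (IsMeasurement (exSeqMeas m d L) ∧
      IsLOCC (fun _ : Fin m => Fin L → Fin d) (exSeqMeas m d L)) ∧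
    -- optimality conditions
    (exH m d L).IsHermitian ∧
    (∀ c : Fin L → Fin (d + 2),
      IsBlockPositive (X := fun _ : Fin m => Fin L → Fin d)
        (exH m d L - (exSeq m d L hm hd).η c • (exSeq m d L hm hd).ρ c) ∧
      (exSeqMeas m d L c *
        (exH m d L - (exSeq m d L hm hd).η c • (exSeq m d L hm hd).ρ c)).trace = 0) ∧
    -- the optimal LOCC discrimination is factorizable, and optimal among separable measurements
    Factorizable (fun _ : Fin L => exEnsemble m d hm hd) ∧
    (exSeq m d L hm hd).pL = (exSeq m d L hm hd).pSEP ∧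
    -- the measurements above attain the optimal LOCC success probabilities
    (exEnsemble m d hm hd).success (exMeas m d) = (exEnsemble m d hm hd).pL ∧
    (exSeq m d L hm hd).success (exSeqMeas m d L) = (exSeq m d L hm hd).pL ∧
    -- a single step
    (exEnsemble m d hm hd).pL = (d : ℝ) ^ m / ((d : ℝ) ^ m + d) ∧
    iSup (exEnsemble m d hm hd).η < (exEnsemble m d hm hd).pL ∧
    (exEnsemble m d hm hd).pL < (exEnsemble m d hm hd).pG ∧
    -- the sequence
    iSup (exSeq m d L hm hd).η < (exSeq m d L hm hd).pL ∧
    (exSeq m d L hm hd).pL < (exSeq m d L hm hd).pG := by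
  have : NeZero L := ⟨by omega⟩
  refine ⟨isSepOp_exState_iff hm hd, ⟨exLabel hm, fun i => ?_⟩,
    ⟨isMeasurement_exMeas hm, isLOCC_exMeas hm hd⟩,
    ⟨isMeasurement_exSeqMeas hm L, isLOCC_exSeqMeas hm hd L⟩, isHermitian_exH L,
    fun c => ⟨(exSeq_isOptimalityCertificate hm hd L).isBlockPositive c,
      (exSeq_isOptimalityCertificate hm hd L).trace_mul_eq_zero c⟩,
    factorizable_exEnsemble hm hd L, (pL_exSeq hm hd L).trans (pSEP_exSeq hm hd L).symm,
    (pL_exEnsemble hm hd).symm, (pL_exSeq hm hd L).symm,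
    (pL_exEnsemble hm hd).trans (success_exMeas hm hd), ?_, ?_, ?_,
    pL_exSeq_lt_pG hm hd (by omega)⟩
  · rw [exMeas_eq_basisMeas hm]
    exact basisMeas_eq_sum _ i
  · obtain ⟨i, hi⟩ := exists_eq_ciSup_of_finite (f := (exEnsemble m d hm hd).η)
    exact hi ▸ exProb_lt_pL hm hd i
  · exact (pL_exEnsemble_lt_success_exGlobalMeas hm hd).trans_le
      (Ensemble.success_le_pG (isMeasurement_exGlobalMeas hm hd))
  · obtain ⟨c, hc⟩ := exists_eq_ciSup_of_finite (f := (exSeq m d L hm hd).η)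
    exact hc ▸ exSeq_η_lt_pL hm hd (by omega) c
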